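/- Let $(W,S)$ be a Coxeter system with $S$ nonempty (possibly infinite), with Coxeter matrix $(m_{s,t})_{s,t\in S}$ and length function $\ell$, and let $M$ be the associated Artin–Tits monoid, that is, the monoid generated by $S$ subject to the relations $sts\cdots = tst\cdots$ (both sides alternating words of length $m_{s,t}$) for all $s\neq t$ in $S$ with $m_{s,t}<\infty$. Let $\pi:M\to W$ be the canonical projection, which maps each generator $s$ to $s$. For $f,g\in M$, write $f\preceq g$ if $fg'=g$ for some $g'\in M$. A *Garside family* of $M$ is a subset $F\subseteq M$ that contains $1$ and is such that every $g\in M$ can be written $g=s_1\cdots s_p$ with $s_1,\dots,s_p\in F$ and, for every $i<p$, every $s\in F$ and every $f\in M$, $s\preceq fs_is_{i+1}$ implies $s\preceq fs_i$. The right weak order on $W$ is defined by $u\le w$ if and only if there is $v\in W$ with $w=uv$ and $\ell(w)=\ell(u)+\ell(v)$. The join of $u,v\in W$ is their least common upper bound for $\le$, when it exists. An element $v$ is a suffix of $w$ if some reduced word for $v$ is a suffix of some reduced word for $w$. A subset $A\subseteq W$ is closed under join if the join of any two elements of $A$ lies in $A$ whenever it exists, and closed under suffix if every suffix of an element of $A$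 lies in $A$. Then $M$ has a smallest Garside family $F$ with respect to inclusion, and $\pi(F)$ is the smallest subset of $W$ that includes $S$ and is closed under join and suffix. -/

import Mathlib

/-- The defining relations of the Artin–Tits monoid of a Coxeter matrix: for each pair of
generators `i`, `j` with `M i j` finite (Mathlib encodes `∞` as `0`), the two alternating words
in `i`, `j` of length `M i j` are identified. -/
inductive CoxeterMatrix.ArtinTitsRel {B : Type*} (M : CoxeterMatrix B) :
    FreeMonoid B → FreeMonoid B → Prop
  | braid (i j : B) (h : M i j ≠ 0) :
      CoxeterMatrix.ArtinTitsRel M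
        (FreeMonoid.ofList (CoxeterSystem.alternatingWord i j (M i j)))
        (FreeMonoid.ofList (CoxeterSystem.alternatingWord j i (M i j)))

/-- The Artin–Tits monoid associated with a Coxeter matrix. -/
abbrev CoxeterMatrix.ArtinTitsMonoid {B : Type*} (M : CoxeterMatrix B) : Type _ :=
  PresentedMonoid M.ArtinTitsRel

theorem CoxeterSystem.artinTitsRel_lift {B W : Type*} [Group W] {M : CoxeterMatrix B}
    (cs : CoxeterSystem M W) (a b : FreeMonoid B) (h : M.ArtinTitsRel a b) :
    FreeMonoid.lift cs.simple a = FreeMonoid.lift cs.simple b := by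
  obtain ⟨i, j, _⟩ := h
  have key := cs.wordProd_braidWord_eq i j
  rw [CoxeterSystem.braidWord, CoxeterSystem.braidWord, M.symmetric j i] at key
  simpa [FreeMonoid.lift_apply, CoxeterSystem.wordProd] using key

/-- The canonical projection `π` from the Artin–Tits monoid to the Coxeter group, sending each
generator to the corresponding simple reflection. -/
def CoxeterSystem.artinTitsProj {B W : Type*} [Group W] {M : CoxeterMatrix B}
    (cs : CoxeterSystem M W) : M.ArtinTitsMonoid →* W :=
  PresentedMonoid.lift cs.simple cs.artinTitsRel_lift

/-- `l = (s₁, …, sₚ)` is `F`-normal: all entries lie in `F`, and for all consecutive entries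
`sᵢ, sᵢ₊₁`, all `s ∈ F` and all `f`, if `s` left-divides `f sᵢ sᵢ₊₁` then `s` left-divides `f sᵢ`.
In a (noncommutative) monoid, Mathlib's `a ∣ b` is left-divisibility: `∃ c, b = a * c`. -/
def IsNormalSequence {G : Type*} [Monoid G] (F : Set G) (l : List G) : Prop :=
  (∀ a ∈ l, a ∈ F) ∧
    l.IsChain (fun a b => ∀ s ∈ F, ∀ f : G, s ∣ f * a * b → s ∣ f * a)

/-- A Garside family: it contains `1`, and every element of the monoid admits an `F`-normal
decomposition. (The notion is meant for left-cancellative monoids with no nontrivial invertible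
element, as Artin–Tits monoids are.) -/
def IsGarsideFamily {G : Type*} [Monoid G] (F : Set G) : Prop :=
  1 ∈ F ∧ ∀ g : G, ∃ l : List G, l.prod = g ∧ IsNormalSequence F l

namespace CoxeterSystem

variable {B W : Type*} [Group W] {M : CoxeterMatrix B} (cs : CoxeterSystem M W)

/-- The right weak order `u ≤ w`. -/
def RightWeakLE (u w : W) : Prop :=
  ∃ v : W, w = u * v ∧ cs.length w = cs.length u + cs.length v

/-- `w` is the join (least common upper bound) of `u` and `v` in the right weak order. -/
def IsJoin (u v w : W) : Prop :=
  cs.RightWeakLE u w ∧ cs.RightWeakLE v w ∧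
    ∀ x : W, cs.RightWeakLE u x → cs.RightWeakLE v x → cs.RightWeakLE w x

/-- `v` is a suffix of `w`: some reduced word for `v` is a suffix of some reduced word for `w`. -/
def IsSuffixOf (v w : W) : Prop :=
  ∃ ω' ω : List B, cs.IsReduced ω' ∧ cs.wordProd ω' = v ∧
    cs.IsReduced ω ∧ cs.wordProd ω = w ∧ ω' <:+ ω

/-- The join of two elements of `A` belongs to `A` whenever it exists. -/
def JoinClosed (A : Set W) : Prop :=
  ∀ u ∈ A, ∀ v ∈ A, ∀ w : W, cs.IsJoin u v w → w ∈ A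

/-- Every suffix of an element of `A` belongs to `A`. -/
def SuffixClosed (A : Set W) : Prop :=
  ∀ w ∈ A, ∀ v : W, cs.IsSuffixOf v w → v ∈ A

end CoxeterSystem

/-! By Matsumoto's theorem, sending `w` to the class of any reduced word gives a section
`artinLift`, written σ, of the projection π. Every `g` in the monoid has a head, the greatest `w`
with σ(w) dividing `g`, so that σ(u) ∣ g means `u ≤ head g` (`artinLift_dvd_iff`). Divisibility by
lifts thus becomes the weak order, where bounded pairs have joins (`exists_isJoin`).

Let A be the intersection of all subsets of W that include S and are closed under join and suffix.
Then F = σ(A) is a Garside family: join closure gives each `g` a greatest divisor in F, which is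
split off greedily. For normality, if σ(c) ∣ fk with c ∈ A, then some d ∈ A satisfies σ(d) ∣ k and
σ(c) ∣ fσ(d). For `f` a generator s, the join of s and c is sd, and d lies in A by suffix closure
(`exists_mem_artinLift_dvd_mul`).

Conversely, for any Garside family F', the set σ⁻¹(F') includes S and is closed under join and
suffix, because the first entry of a normal decomposition absorbs every divisor in F'. So A ⊆
σ⁻¹(F'), that is, F ⊆ F'; and π(F) = A since πσ = id.

The Coxeter input is the exchange property, from an action on signed reflections, and the exact
order of a product of two generators, from the geometric representation. -/

namespace CoxeterSystem

/-! ### Signed reflections and the exchange property -/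

section Exchange

open List

/-- The word of length `n` alternating between `i` and `j` and beginning with `i`. -/
def altList {B : Type*} (i j : B) : ℕ → List B
  | 0 => []
  | n + 1 => i :: altList j i n

@[simp] theorem length_altList {B : Type*} (i j : B) (n : ℕ) : (altList i j n).length = n := by
  induction n generalizing i j with
  | zero => rfl
  | succ n ih => simp [altList, ih]

/-- `alternatingWord` fixes its last letter and `altList` its first, so parity decides which letter
leads. -/
theorem alternatingWord_eq_altList {B : Type*} (i j : B) (n : ℕ) :
    alternatingWord i j n = if Even n then altList i j n else altList j i n := by
  induction n with
  | zero => simp [alternatingWord, altList]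
  | succ n ih =>
    rw [alternatingWord_succ', ih]
    by_cases h : Even n
    · simp [h, altList, Nat.even_add_one]
    · simp [h, altList, Nat.even_add_one]

variable {B W : Type*} [Group W] {M : CoxeterMatrix B} (cs : CoxeterSystem M W)

theorem wordProd_altList_two_mul (i j : B) (n : ℕ) :
    cs.wordProd (altList i j (2 * n)) = (cs.simple i * cs.simple j) ^ n := by
  induction n with
  | zero => simp [altList]
  | succ n ih => simp [Nat.mul_succ, altList, wordProd_cons, ih, pow_succ', mul_assoc]

theorem leftInvSeq_cons (i : B) (ω : List B) :
    cs.leftInvSeq (i :: ω) = cs.simple i :: (cs.leftInvSeq ω).map (MulAut.conj (cs.simple i)) := rfl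

theorem leftInvSeq_altList (i j : B) (n : ℕ) :
    cs.leftInvSeq (altList i j n) =
      (range n).map fun k => (cs.simple i * cs.simple j) ^ k * cs.simple i := by
  induction n generalizing i j with
  | zero => simp [altList]
  | succ n ih =>
    rw [altList, leftInvSeq_cons, ih, range_succ_eq_map]
    simp only [map_cons, pow_zero, one_mul, map_map, cons.injEq, true_and]
    refine map_congr_left fun k _ => ?_
    have h : ∀ k : ℕ, cs.simple i * (cs.simple j * cs.simple i) ^ k * cs.simple j =
        (cs.simple i * cs.simple j) ^ (k + 1) := by
      intro k
      induction k with
      | zero => simp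
      | succ k ih => rw [pow_succ, pow_succ _ (k + 1), ← ih]; simp only [mul_assoc]
    simp [← h, mul_assoc]

theorem leftInvSeq_append (ω ω' : List B) :
    cs.leftInvSeq (ω ++ ω') =
      cs.leftInvSeq ω ++ (cs.leftInvSeq ω').map (MulAut.conj (cs.wordProd ω)) := by
  induction ω with
  | nil => simp
  | cons i ω ih => simp [leftInvSeq_cons, ih, wordProd_cons]

open Classical in
/-- The action of a simple reflection on signed reflections. -/
noncomputable def signAct (i : B) : Function.End (W × ZMod 2) := fun p =>
  (cs.simple i * p.1 * cs.simple i, p.2 + if p.1 = cs.simple i then 1 else 0)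

open Classical in
-- A letter flips the sign exactly when the conjugate of `t` reached so far equals it, that is, when
-- `t` is the matching entry of the left inversion sequence. The word is reversed because self-maps
-- act rightmost first.
theorem prod_map_signAct_reverse (ω : List B) (t : W) (ε : ZMod 2) :
    (ω.reverse.map cs.signAct).prod (t, ε) =
      ((cs.wordProd ω)⁻¹ * t * cs.wordProd ω, ε + ((cs.leftInvSeq ω).count t : ℕ)) := by
  induction ω generalizing t ε with
  | nil => simp; rfl
  | cons i ω ih =>
    rw [reverse_cons, map_append, prod_append]
    change (ω.reverse.map cs.signAct).prod ((map cs.signAct [i]).prod (t, ε)) = _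
    rw [map_singleton, prod_singleton, signAct, ih]
    have hc : count (cs.simple i * t * cs.simple i) (cs.leftInvSeq ω) =
        count t ((cs.leftInvSeq ω).map (MulAut.conj (cs.simple i))) := by
      rw [← count_map_of_injective (cs.leftInvSeq ω) (MulAut.conj (cs.simple i))
        (MulAut.conj (cs.simple i)).injective]
      simp [mul_assoc]
    refine Prod.ext ?_ ?_
    · simp [wordProd_cons, mul_assoc]
    · simp only [leftInvSeq_cons, count_cons, hc, beq_iff_eq, Nat.cast_add, Nat.cast_ite,
        Nat.cast_one, Nat.cast_zero, eq_comm (a := t)]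
      ring

/-- The left inversion sequence of the alternating word of length `2 * M i j` is its first half
repeated, so every reflection occurs an even number of times and no sign changes. -/
theorem isLiftable_signAct : M.IsLiftable cs.signAct := by
  classical
  intro i j
  have h : ∀ n : ℕ, (((altList j i (2 * n)).reverse).map cs.signAct).prod =
      (cs.signAct i * cs.signAct j) ^ n := by
    intro n
    induction n with
    | zero => simp [altList]
    | succ n ih => rw [pow_succ, ← ih]; simp [Nat.mul_succ, altList]
  rw [← h]
  funext ⟨t, ε⟩
  rw [prod_map_signAct_reverse, wordProd_altList_two_mul, leftInvSeq_altList, two_mul, range_add,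
    map_append, map_map, count_append]
  have hp := cs.simple_mul_simple_pow' i j
  rw [hp]
  have h2 : ((range (M i j)).map ((fun k => (cs.simple j * cs.simple i) ^ k * cs.simple j) ∘
      (M i j + ·))) = (range (M i j)).map fun k => (cs.simple j * cs.simple i) ^ k * cs.simple j :=
    map_congr_left fun k _ => by simp [pow_add, hp]
  rw [h2, Nat.cast_add, CharTwo.add_self_eq_zero]
  simp
  rfl

theorem prod_map_lift_signAct (ω : List B) :
    (ω.map cs.signAct).prod = cs.lift ⟨cs.signAct, cs.isLiftable_signAct⟩ (cs.wordProd ω) := by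
  rw [wordProd, map_list_prod, map_map]
  congr 1
  exact map_congr_left fun i _ => (cs.lift_apply_simple cs.isLiftable_signAct i).symm

open Classical in
theorem count_leftInvSeq_congr {ω ω' : List B} (h : cs.wordProd ω = cs.wordProd ω') (t : W) :
    ((cs.leftInvSeq ω).count t : ZMod 2) = (cs.leftInvSeq ω').count t := by
  have h1 := cs.prod_map_signAct_reverse ω t 0
  have h2 := cs.prod_map_signAct_reverse ω' t 0
  rw [prod_map_lift_signAct, wordProd_reverse] at h1 h2
  rw [h, h2] at h1
  simpa using (congrArg Prod.snd h1).symm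

/-- **Exchange property**: a left descent occurs in the left inversion sequence of every word. -/
theorem simple_mem_leftInvSeq {ω : List B} {i : B} (h : cs.IsLeftDescent (cs.wordProd ω) i) :
    cs.simple i ∈ cs.leftInvSeq ω := by
  classical
  -- Compare `ω` with `i :: ω'`, a word for the same element in whose sequence `s i` occurs exactly
  -- once: its count in `ω` is odd.
  obtain ⟨ω', hω', hp⟩ := cs.exists_isReduced (cs.simple i * cs.wordProd ω)
  have hn : cs.simple i ∉ cs.leftInvSeq ω' := by
    intro hm
    have := (cs.isLeftInversion_of_mem_leftInvSeq hω' hm).2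
    rw [← hp, simple_mul_simple_cancel_left] at this
    exact absurd h (not_lt_of_gt this)
  have hc := cs.count_leftInvSeq_congr (ω := ω) (ω' := i :: ω')
    (by rw [wordProd_cons, ← hp, simple_mul_simple_cancel_left]) (cs.simple i)
  have h0 : count (cs.simple i) ((cs.leftInvSeq ω').map (MulAut.conj (cs.simple i))) = 0 := by
    refine count_eq_zero.2 fun hm => hn ?_
    obtain ⟨t, ht, hte⟩ := mem_map.1 hm
    have : t = cs.simple i := by
      have h3 : cs.simple i * t * cs.simple i = cs.simple i := by simpa using hte
      have h4 : cs.simple i * t = 1 := mul_eq_right.1 h3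
      rw [← cs.inv_simple i]; exact eq_inv_of_mul_eq_one_right h4
    exact this ▸ ht
  rw [leftInvSeq_cons, count_cons_self, h0] at hc
  by_contra hcon
  rw [count_eq_zero.2 hcon] at hc
  simp at hc

end Exchange

end CoxeterSystem

namespace CoxeterMatrix

/-! ### Geometric representation and orders of products of two generators -/

section GeometricRepresentation

open Module Polynomial.Chebyshev

variable {B : Type*} (M : CoxeterMatrix B)

/-- The coroot of `i` in the geometric representation, normalized to take the value `2` on the
simple root `i`. -/
noncomputable def coroot (i : B) : Dual ℝ (B →₀ ℝ) :=
  Finsupp.linearCombination ℝ fun j => -2 * Real.cos (Real.pi / M i j)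

theorem coroot_single (i j : B) :
    M.coroot i (Finsupp.single j 1) = -2 * Real.cos (Real.pi / M i j) := by
  simp [coroot]

theorem coroot_single_self (i : B) : M.coroot i (Finsupp.single i 1) = 2 := by
  simp [coroot_single]

/-- The simple reflection of index `i` in the geometric representation. -/
noncomputable def geomReflection (i : B) : (B →₀ ℝ) ≃ₗ[ℝ] (B →₀ ℝ) :=
  reflection (M.coroot_single_self i)

theorem coroot_mul_coroot_sub_two (i j : B) :
    M.coroot i (Finsupp.single j 1) * M.coroot j (Finsupp.single i 1) - 2 =
      2 * Real.cos (2 * (Real.pi / M i j)) := by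
  rw [coroot_single, coroot_single, M.symmetric j i, Real.cos_two_mul]
  ring

theorem sin_two_mul_pi_div_ne_zero {m : ℕ} (hm : 3 ≤ m) : Real.sin (2 * (Real.pi / m)) ≠ 0 := by
  have h3 : (3 : ℝ) ≤ m := by exact_mod_cast hm
  have hpi := Real.pi_pos
  have h1 : Real.pi / m ≤ Real.pi / 3 := by gcongr
  have h0 : 0 < Real.pi / m := by positivity
  exact (Real.sin_pos_of_pos_of_lt_pi (by linarith) (by linarith)).ne'

/-- With θ = π / m, powers of the product are governed by the Chebyshev values S_n(2 cos 2θ) =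
sin((n+1)2θ) / sin 2θ. For m = 2k the value at n = k-1 vanishes; for m = 2k+1 those at k and k-1
cancel. The quotient needs sin 2θ ≠ 0, so m < 3 is treated apart. -/
theorem isLiftable_geomReflection : M.IsLiftable M.geomReflection := by
  intro i j
  rcases eq_or_ne i j with rfl | hij
  · rw [M.diagonal, pow_one]
    ext1 z
    exact involutive_reflection (M.coroot_single_self i) z
  have h1 := M.off_diagonal i j hij
  rcases Nat.lt_or_ge (M i j) 3 with hlt | hge
  · have h02 : M i j = 0 ∨ M i j = 2 := by omega
    rcases h02 with h0 | h2
    · rw [h0, pow_zero]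
    · have hc : M.coroot i (Finsupp.single j 1) = 0 := by simp [coroot_single, h2]
      have hc' : M.coroot j (Finsupp.single i 1) = 0 := by
        simp [coroot_single, M.symmetric j i, h2]
      rw [h2, pow_two]
      ext1 z
      simp only [geomReflection, LinearEquiv.mul_apply, reflection_apply, map_sub, map_smul, hc, hc',
        coroot_single_self, LinearEquiv.coe_one, id_eq]
      module
  · have hs := sin_two_mul_pi_div_ne_zero hge
    have hS : ∀ n : ℤ, (S ℝ n).eval (2 * Real.cos (2 * (Real.pi / M i j))) =
        Real.sin ((n + 1) * (2 * (Real.pi / M i j))) / Real.sin (2 * (Real.pi / M i j)) := by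
      intro n
      rw [eq_div_iff hs, S_two_mul_real_cos]
    ext1 z
    rw [geomReflection, geomReflection, reflection_mul_reflection_pow_apply _ _ _ _
      (2 * Real.cos (2 * (Real.pi / M i j))) (M.coroot_mul_coroot_sub_two i j).symm]
    have hm0 : (M i j : ℝ) ≠ 0 := by
      have : M i j ≠ 0 := by omega
      exact_mod_cast this
    generalize hm : M i j = m at *
    rcases Nat.even_or_odd' m with ⟨k, hk | hk⟩
    · have e1 : ((m : ℤ) - 2) / 2 = k - 1 := by omega
      have e2 : ((m : ℤ) - 1) / 2 = k - 1 := by omega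
      have hz : (S ℝ ((k : ℤ) - 1)).eval (2 * Real.cos (2 * (Real.pi / m))) = 0 := by
        rw [hS]
        have : (((k : ℤ) - 1 : ℤ) + 1 : ℝ) * (2 * (Real.pi / m)) = Real.pi := by
          have : (m : ℝ) = 2 * k := by exact_mod_cast hk
          push_cast
          field_simp
          rw [this]; ring
        rw [this, Real.sin_pi, zero_div]
      rw [e1, e2, hz]
      simp
    · have e1 : ((m : ℤ) - 2) / 2 = k - 1 := by omega
      have e2 : ((m : ℤ) - 1) / 2 = k := by omega
      have e3 : ((m : ℤ) - 3) / 2 = k - 1 := by omega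
      have e4 : (m : ℤ) / 2 = k := by omega
      have hz : (S ℝ (k : ℤ)).eval (2 * Real.cos (2 * (Real.pi / m))) +
          (S ℝ ((k : ℤ) - 1)).eval (2 * Real.cos (2 * (Real.pi / m))) = 0 := by
        rw [hS, hS, ← add_div]
        have : (((k : ℤ) - 1 : ℤ) + 1 : ℝ) * (2 * (Real.pi / m)) =
            2 * Real.pi - ((k : ℤ) + 1 : ℝ) * (2 * (Real.pi / m)) := by
          have : (m : ℝ) = 2 * k + 1 := by exact_mod_cast hk
          push_cast
          field_simp
          rw [this]; ring
        rw [this, Real.sin_two_pi_sub]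
        simp
      rw [e1, e2, e3, e4, hz]
      simp

/-- Evaluate at the simple root `i`. For m ≥ 3, the two coordinates force sin(2nθ) = 0 and cos(2nθ)
= 1 with θ = π / m, impossible since 0 < 2nθ < 2π. -/
theorem geomReflection_mul_pow_ne_one {i j : B} (hij : i ≠ j) {n : ℕ} (hn : 0 < n)
    (hm : M i j = 0 ∨ n < M i j) : (M.geomReflection i * M.geomReflection j) ^ n ≠ 1 := by
  intro h
  have h1 := M.off_diagonal i j hij
  have key := reflection_mul_reflection_pow_apply_self (M.coroot_single_self i)
    (M.coroot_single_self j) n (2 * Real.cos (2 * (Real.pi / M i j)))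
    (M.coroot_mul_coroot_sub_two i j).symm
  change ((M.geomReflection i * M.geomReflection j) ^ n) _ = _ at key
  rw [h] at key
  have ki := DFunLike.congr_fun key i
  have kj := DFunLike.congr_fun key j
  simp [hij, hij.symm, coroot_single, M.symmetric j i] at ki kj
  rcases Nat.lt_or_ge (M i j) 3 with hlt | hge
  · have h02 : M i j = 0 ∨ M i j = 2 := by omega
    rcases h02 with h0 | h2
    -- Here `Real.pi / 0 = 0`, so the Chebyshev argument is 2, and S_{n-1}(2) = n is nonzero.
    · have := hn.ne'
      simp [h0] at kj
      exact this kj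
    · have : n = 1 := by omega
      subst this
      simp [h2] at ki
      rw [mul_div_cancel₀ _ (two_ne_zero' ℝ), Real.cos_pi] at ki
      norm_num at ki
  · have hs := sin_two_mul_pi_div_ne_zero hge
    have hnm : n < M i j := by omega
    have hm3 : (3 : ℝ) ≤ M i j := by exact_mod_cast hge
    have hpi := Real.pi_pos
    have hcos : Real.cos (Real.pi / M i j) ≠ 0 := by
      intro h0
      apply hs
      rw [Real.sin_two_mul, h0, mul_zero]
    have kj' := kj.resolve_right hcos
    rw [kj', add_zero] at ki
    have s1 := S_two_mul_real_cos (2 * (Real.pi / M i j)) n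
    have s2 := S_two_mul_real_cos (2 * (Real.pi / M i j)) ((n : ℤ) - 1)
    rw [← ki] at s1
    rw [kj'] at s2
    push_cast at s1 s2
    rw [sub_add_cancel, zero_mul] at s2
    rw [add_mul, one_mul, one_mul, Real.sin_add, ← s2, zero_mul, zero_add] at s1
    have hc1 : Real.cos (n * (2 * (Real.pi / M i j))) = 1 :=
      (mul_eq_right₀ hs).1 s1.symm
    have hx0 : 0 < n * (2 * (Real.pi / M i j)) := by
      have : (0 : ℝ) < n := by exact_mod_cast hn
      have : (0 : ℝ) < M i j := by linarith
      positivity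
    have hx1 : n * (2 * (Real.pi / M i j)) < 2 * Real.pi := by
      have h5 : (n : ℝ) < M i j := by exact_mod_cast hnm
      have h4 : (0 : ℝ) < M i j := by linarith
      have : n * (2 * (Real.pi / M i j)) = 2 * Real.pi * (n / M i j) := by ring
      rw [this]
      have : (n : ℝ) / M i j < 1 := (div_lt_one h4).2 h5
      nlinarith
    rw [Real.cos_eq_one_iff_of_lt_of_lt (by linarith) hx1] at hc1
    exact hx0.ne' hc1

end GeometricRepresentation

end CoxeterMatrix

/-- A product of two distinct simple reflections has no smaller order than prescribed. -/
theorem CoxeterSystem.simple_mul_simple_pow_ne_one {B W : Type*} [Group W] {M : CoxeterMatrix B}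
    (cs : CoxeterSystem M W) {i j : B} (hij : i ≠ j) {n : ℕ} (hn : 0 < n)
    (hm : M i j = 0 ∨ n < M i j) : (cs.simple i * cs.simple j) ^ n ≠ 1 := by
  intro h
  have := congrArg (cs.lift ⟨M.geomReflection, M.isLiftable_geomReflection⟩) h
  rw [map_pow, map_mul, cs.lift_apply_simple, cs.lift_apply_simple, map_one] at this
  exact M.geomReflection_mul_pow_ne_one hij hn hm this

namespace CoxeterSystem

/-! ### Reduced products and the right weak order -/

section WeakOrder

variable {B W : Type*} [Group W] {M : CoxeterMatrix B} (cs : CoxeterSystem M W)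

/-- The product `u * v` is reduced: lengths add up. -/
def Red (u v : W) : Prop := cs.length (u * v) = cs.length u + cs.length v

variable {cs} {u v w x y z : W}

theorem Red.assoc (h : cs.Red u v) (h' : cs.Red (u * v) x) : cs.Red v x ∧ cs.Red u (v * x) := by
  have h1 := cs.length_mul_le v x
  have h2 := cs.length_mul_le u (v * x)
  unfold Red at *
  rw [mul_assoc] at h'
  omega

theorem Red.assoc' (h : cs.Red v x) (h' : cs.Red u (v * x)) : cs.Red u v ∧ cs.Red (u * v) x := by
  have h1 := cs.length_mul_le u v
  have h2 := cs.length_mul_le (u * v) x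
  unfold Red at *
  rw [mul_assoc] at *
  omega

theorem red_one (u : W) : cs.Red u 1 := by simp [Red]

theorem one_red (u : W) : cs.Red 1 u := by simp [Red]

theorem Red.inv (h : cs.Red u v) : cs.Red v⁻¹ u⁻¹ := by
  unfold Red at *
  rw [← mul_inv_rev, length_inv, length_inv, length_inv, h, add_comm]

theorem rightWeakLE_iff : cs.RightWeakLE u w ↔ ∃ v, w = u * v ∧ cs.Red u v := by
  refine exists_congr fun v => and_congr_right fun h => ?_
  rw [Red, ← h]

theorem Red.le (h : cs.Red u v) : cs.RightWeakLE u (u * v) := rightWeakLE_iff.2 ⟨v, rfl, h⟩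

theorem RightWeakLE.refl (u : W) : cs.RightWeakLE u u := ⟨1, by simp, by simp⟩

theorem RightWeakLE.one_le (u : W) : cs.RightWeakLE 1 u := ⟨u, by simp, by simp⟩

theorem RightWeakLE.trans (h : cs.RightWeakLE u v) (h' : cs.RightWeakLE v w) :
    cs.RightWeakLE u w := by
  obtain ⟨a, rfl, ha⟩ := rightWeakLE_iff.1 h
  obtain ⟨b, rfl, hb⟩ := rightWeakLE_iff.1 h'
  rw [mul_assoc]
  exact (ha.assoc hb).2.le

theorem RightWeakLE.length_le (h : cs.RightWeakLE u v) : cs.length u ≤ cs.length v := by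
  obtain ⟨a, -, ha⟩ := h
  omega

theorem RightWeakLE.eq_of_length_le (h : cs.RightWeakLE u v) (hl : cs.length v ≤ cs.length u) :
    u = v := by
  obtain ⟨a, rfl, ha⟩ := h
  have : a = 1 := cs.length_eq_zero_iff.1 (by omega)
  simp [this]

theorem RightWeakLE.antisymm (h : cs.RightWeakLE u v) (h' : cs.RightWeakLE v u) : u = v :=
  h.eq_of_length_le h'.length_le

theorem Red.of_le (h : cs.Red u v) (hx : cs.RightWeakLE x v) : cs.Red u x := by
  obtain ⟨a, rfl, ha⟩ := rightWeakLE_iff.1 hx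
  exact (ha.assoc' h).1

theorem Red.mul_le_mul (h : cs.Red u v) (hx : cs.RightWeakLE x v) :
    cs.RightWeakLE (u * x) (u * v) := by
  obtain ⟨a, rfl, ha⟩ := rightWeakLE_iff.1 hx
  rw [← mul_assoc]
  exact (ha.assoc' h).2.le

theorem Red.exists_of_mul_le (h : cs.Red u v) (hx : cs.RightWeakLE (u * v) w) :
    ∃ a, w = u * a ∧ cs.Red u a ∧ cs.RightWeakLE v a := by
  obtain ⟨a, rfl, ha⟩ := rightWeakLE_iff.1 hx
  exact ⟨v * a, mul_assoc _ _ _, (h.assoc ha).2, (h.assoc ha).1.le⟩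

theorem Red.le_of_mul_le_mul (h : cs.Red u v) (hx : cs.RightWeakLE (u * v) (u * w)) :
    cs.RightWeakLE v w := by
  obtain ⟨a, ha, -, hv⟩ := h.exists_of_mul_le hx
  exact mul_left_cancel ha ▸ hv

theorem red_simple_iff {i : B} : cs.Red (cs.simple i) w ↔ ¬cs.IsLeftDescent w i := by
  rw [not_isLeftDescent_iff, Red, length_simple, add_comm]

theorem simple_le_iff {i : B} : cs.RightWeakLE (cs.simple i) w ↔ cs.IsLeftDescent w i := by
  constructor
  · intro h
    obtain ⟨v, rfl, hv⟩ := rightWeakLE_iff.1 h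
    rw [Red, length_simple] at hv
    rw [IsLeftDescent, simple_mul_simple_cancel_left]
    omega
  · intro h
    rw [isLeftDescent_iff] at h
    refine ⟨cs.simple i * w, by simp, ?_⟩
    rw [length_simple]
    omega

/-! ### Dihedral parabolic subgroups -/

theorem wordProd_altList_succ (a b : B) (n : ℕ) :
    cs.wordProd (altList a b (n + 1)) = cs.simple a * cs.wordProd (altList b a n) :=
  cs.wordProd_cons _ _

theorem wordProd_altList_braid (cs : CoxeterSystem M W) (a b : B) :
    cs.wordProd (altList a b (M a b)) = cs.wordProd (altList b a (M a b)) := by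
  have h := cs.wordProd_braidWord_eq a b
  rw [braidWord, braidWord, M.symmetric b a, alternatingWord_eq_altList,
    alternatingWord_eq_altList] at h
  split_ifs at h
  · exact h
  · exact h.symm

theorem wordProd_altList_mem {H : Subgroup W} {a b : B} (ha : cs.simple a ∈ H)
    (hb : cs.simple b ∈ H) (n : ℕ) : cs.wordProd (altList a b n) ∈ H := by
  induction n generalizing a b with
  | zero => simp [altList]
  | succ n ih => exact wordProd_altList_succ (cs := cs) a b n ▸ H.mul_mem ha (ih hb ha)

/-- If a new letter shortened the product, exchange would place it in the left inversion sequence.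
In the alternating part this contradicts the order of the product of the two generators; in the part
of `y` it yields a reflection in `H` shortening `y`, against minimality. -/
theorem length_wordProd_altList_mul {H : Subgroup W} (hy : ∀ x ∈ H, cs.length y ≤ cs.length (x * y))
    {a b : B} (hab : a ≠ b) (ha : cs.simple a ∈ H) (hb : cs.simple b ∈ H) {k : ℕ}
    (hk : M a b = 0 ∨ k ≤ M a b) :
    cs.length (cs.wordProd (altList a b k) * y) = k + cs.length y := by
  induction k generalizing a b with
  | zero => simp [altList]
  | succ k ih =>
    have hk' : M b a = 0 ∨ k ≤ M b a := by rw [M.symmetric b a]; omega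
    have ih' := ih hab.symm hb ha hk'
    rw [wordProd_altList_succ, mul_assoc]
    suffices h : ¬cs.IsLeftDescent (cs.wordProd (altList b a k) * y) a by
      rw [not_isLeftDescent_iff] at h
      rw [h, ih']
      omega
    obtain ⟨ω, hω, rfl⟩ := cs.exists_isReduced y
    rw [← wordProd_append]
    intro hd
    have hm := cs.simple_mem_leftInvSeq hd
    rw [leftInvSeq_append, leftInvSeq_altList, List.mem_append, List.mem_map, List.mem_map] at hm
    rcases hm with ⟨i, hi, he⟩ | ⟨t, ht, he⟩
    · rw [List.mem_range] at hi
      refine cs.simple_mul_simple_pow_ne_one hab.symm (Nat.succ_pos i)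
        (by rw [M.symmetric b a]; omega) ?_
      rw [pow_succ, ← mul_assoc, he, simple_mul_simple_self]
    · have ht' : t ∈ H := by
        rw [MulAut.conj_apply] at he
        have h1 := wordProd_altList_mem (cs := cs) hb ha k
        have : t = (cs.wordProd (altList b a k))⁻¹ * cs.simple a * cs.wordProd (altList b a k) := by
          rw [← he]; group
        rw [this]
        exact H.mul_mem (H.mul_mem (H.inv_mem h1) ha) h1
      have h1 := (cs.isLeftInversion_of_mem_leftInvSeq hω ht).2
      exact absurd (hy t ht') (not_le_of_gt h1)

theorem length_wordProd_altList {a b : B} (hab : a ≠ b) {k : ℕ} (hk : M a b = 0 ∨ k ≤ M a b) :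
    cs.length (cs.wordProd (altList a b k)) = k := by
  simpa using length_wordProd_altList_mul (cs := cs) (y := 1) (H := ⊤) (by simp) hab
    trivial trivial hk

theorem isReduced_altList {a b : B} (hab : a ≠ b) {k : ℕ} (hk : M a b = 0 ∨ k ≤ M a b) :
    cs.IsReduced (altList a b k) := by
  rw [IsReduced, length_wordProd_altList hab hk, length_altList]

theorem exists_simple_mul_eq_wordProd_altList {a b : B} {x : W}
    (h : ∃ k, (M a b = 0 ∨ k ≤ M a b) ∧
      (x = cs.wordProd (altList a b k) ∨ x = cs.wordProd (altList b a k))) :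
    ∃ k, (M a b = 0 ∨ k ≤ M a b) ∧ (cs.simple a * x = cs.wordProd (altList a b k) ∨
      cs.simple a * x = cs.wordProd (altList b a k)) := by
  obtain ⟨k, hk, rfl | rfl⟩ := h
  · rcases k with _ | k
    · exact ⟨1, by omega, Or.inl rfl⟩
    · exact ⟨k, by omega, Or.inr (by rw [wordProd_altList_succ, simple_mul_simple_cancel_left])⟩
  · by_cases hk' : M a b = 0 ∨ k + 1 ≤ M a b
    · exact ⟨k + 1, hk', Or.inl (wordProd_altList_succ a b k).symm⟩
    -- At full length, the braid relation rewrites the word to begin with `a`, which then cancels.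
    · obtain rfl : k = M a b := by omega
      rw [← wordProd_altList_braid]
      obtain ⟨n, hn⟩ := Nat.exists_eq_succ_of_ne_zero (not_or.1 hk').1
      refine ⟨n, by omega, Or.inr ?_⟩
      rw [hn, wordProd_altList_succ, simple_mul_simple_cancel_left]

theorem exists_eq_wordProd_altList_of_mem {a b : B} {x : W}
    (hx : x ∈ Subgroup.closure {cs.simple a, cs.simple b}) :
    ∃ k, (M a b = 0 ∨ k ≤ M a b) ∧
      (x = cs.wordProd (altList a b k) ∨ x = cs.wordProd (altList b a k)) := by
  have hb : ∀ x, (∃ k, (M a b = 0 ∨ k ≤ M a b) ∧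
      (x = cs.wordProd (altList a b k) ∨ x = cs.wordProd (altList b a k))) →
      ∃ k, (M a b = 0 ∨ k ≤ M a b) ∧ (cs.simple b * x = cs.wordProd (altList a b k) ∨
        cs.simple b * x = cs.wordProd (altList b a k)) := by
    intro x h
    have := exists_simple_mul_eq_wordProd_altList (cs := cs) (a := b) (b := a) (x := x)
    simp only [M.symmetric b a] at this
    simp only [or_comm (b := _ = cs.wordProd (altList b a _))] at this ⊢
    exact this (by simpa only [or_comm (b := _ = cs.wordProd (altList b a _))] using h)
  have hs : ∀ s ∈ ({cs.simple a, cs.simple b} : Set W), ∀ x, (∃ k, (M a b = 0 ∨ k ≤ M a b) ∧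
      (x = cs.wordProd (altList a b k) ∨ x = cs.wordProd (altList b a k))) →
      ∃ k, (M a b = 0 ∨ k ≤ M a b) ∧
        (s * x = cs.wordProd (altList a b k) ∨ s * x = cs.wordProd (altList b a k)) := by
    rintro s (rfl | rfl) x h
    · exact exists_simple_mul_eq_wordProd_altList h
    · exact hb x h
  induction hx using Subgroup.closure_induction_left with
  | one => exact ⟨0, by omega, by simp [altList]⟩
  | mul_left s hs' y _ ih => exact hs s hs' y ih
  | inv_mul_cancel s hs' y _ ih =>
    have : s⁻¹ = s := by rcases hs' with rfl | rfl <;> simp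
    rw [this]
    exact hs s hs' y ih

/-- Take for `y` a shortest element of the coset of `z`. -/
theorem exists_dihedral_decomposition (cs : CoxeterSystem M W) (a b : B) (z : W) :
    ∃ k y, (M a b = 0 ∨ k ≤ M a b) ∧
      (∀ x ∈ Subgroup.closure {cs.simple a, cs.simple b}, cs.length y ≤ cs.length (x * y)) ∧
      (z = cs.wordProd (altList a b k) * y ∨ z = cs.wordProd (altList b a k) * y) := by
  let f : Subgroup.closure {cs.simple a, cs.simple b} → ℕ := fun x => cs.length (x * z)
  have hmin := Function.argmin_le (f := f)
  set g := Function.argmin f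
  obtain ⟨k, hk, h⟩ := exists_eq_wordProd_altList_of_mem (cs := cs) (inv_mem g.2)
  refine ⟨k, g * z, hk, fun x hx => ?_, ?_⟩
  · rw [← mul_assoc]
    exact hmin ⟨x * g, mul_mem hx g.2⟩
  · rcases h with h | h
    · left; rw [← h]; simp
    · right; rw [← h]; simp

theorem simple_mem_closure_left (a b : B) :
    cs.simple a ∈ Subgroup.closure {cs.simple a, cs.simple b} :=
  Subgroup.subset_closure (Set.mem_insert _ _)

theorem simple_mem_closure_right (a b : B) :
    cs.simple b ∈ Subgroup.closure {cs.simple a, cs.simple b} :=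
  Subgroup.subset_closure (Set.mem_insert_of_mem _ rfl)

/-- An element with two left descents `a ≠ b` is above the longest element of the parabolic
subgroup generated by `a` and `b`. -/
theorem wordProd_altList_le_of_simple_le {a b : B} (hab : a ≠ b)
    (ha : cs.RightWeakLE (cs.simple a) z) (hb : cs.RightWeakLE (cs.simple b) z) :
    M a b ≠ 0 ∧ cs.RightWeakLE (cs.wordProd (altList a b (M a b))) z := by
  rw [simple_le_iff] at ha hb
  obtain ⟨k, y, hk, hy, hz⟩ := cs.exists_dihedral_decomposition a b z
  have h1 := fun n => length_wordProd_altList_mul (k := n) hy hab (simple_mem_closure_left a b)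
    (simple_mem_closure_right a b)
  have h2 := fun n => length_wordProd_altList_mul (k := n) hy hab.symm
    (simple_mem_closure_right a b) (simple_mem_closure_left a b)
  simp only [M.symmetric b a] at h2
  -- Below full length, the letter not leading the alternating prefix could be prepended with a gain
  -- in length, so it would not be a descent.
  have hkm : ¬(M a b = 0 ∨ k + 1 ≤ M a b) := by
    intro hk'
    rcases hz with rfl | rfl
    · have h3 := h2 (k + 1) hk'
      rw [wordProd_altList_succ, mul_assoc] at h3
      have h4 := h1 k hk
      rw [IsLeftDescent] at hb
      omega
    · have h3 := h1 (k + 1) hk'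
      rw [wordProd_altList_succ, mul_assoc] at h3
      have h4 := h2 k hk
      rw [IsLeftDescent] at ha
      omega
  obtain rfl : k = M a b := by omega
  rw [← wordProd_altList_braid, or_self] at hz
  refine ⟨by omega, rightWeakLE_iff.2 ⟨y, hz, ?_⟩⟩
  rw [Red, h1 _ hk, length_wordProd_altList hab hk]

/-- Neither letter is a left descent of `u⁻¹`, so `u⁻¹` is shortest in its dihedral coset and
lengths add with the alternating words. -/
theorem Red.wordProd_altList {a b : B} (hab : a ≠ b)
    (ha : cs.Red u (cs.simple a)) (hb : cs.Red u (cs.simple b)) :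
    cs.Red u (cs.wordProd (altList a b (M a b))) := by
  replace ha := ha.inv
  replace hb := hb.inv
  rw [inv_simple, red_simple_iff] at ha hb
  obtain ⟨k, y, hk, hy, hz⟩ := cs.exists_dihedral_decomposition a b u⁻¹
  have h1 := fun n => length_wordProd_altList_mul (k := n) hy hab (simple_mem_closure_left a b)
    (simple_mem_closure_right a b)
  have h2 := fun n => length_wordProd_altList_mul (k := n) hy hab.symm
    (simple_mem_closure_right a b) (simple_mem_closure_left a b)
  simp only [M.symmetric b a] at h2
  have hk0 : k = 0 := by
    rcases k with _ | k
    · rfl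
    · exfalso
      rcases hz with hz | hz
      · have h3 := h1 (k + 1) hk
        have h4 := h2 k (by omega)
        apply ha
        rw [IsLeftDescent, hz, h3, wordProd_altList_succ, mul_assoc, simple_mul_simple_cancel_left,
          h4]
        omega
      · have h3 := h2 (k + 1) hk
        have h4 := h1 k (by omega)
        apply hb
        rw [IsLeftDescent, hz, h3, wordProd_altList_succ, mul_assoc, simple_mul_simple_cancel_left,
          h4]
        omega
  subst hk0
  have hy' : u⁻¹ = y := by simpa [altList] using hz
  have hp : ∃ c d, c ≠ d ∧ M c d = M a b ∧
      cs.simple c ∈ Subgroup.closure {cs.simple a, cs.simple b} ∧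
      cs.simple d ∈ Subgroup.closure {cs.simple a, cs.simple b} ∧
      (cs.wordProd (altList a b (M a b)))⁻¹ = cs.wordProd (altList c d (M a b)) := by
    have hi : (cs.wordProd (altList a b (M a b)))⁻¹ ∈
        Subgroup.closure {cs.simple a, cs.simple b} :=
      inv_mem (wordProd_altList_mem (simple_mem_closure_left a b) (simple_mem_closure_right a b) _)
    obtain ⟨n, hn, he⟩ := exists_eq_wordProd_altList_of_mem hi
    have hl := length_wordProd_altList (cs := cs) hab (k := M a b) (by omega)
    rw [← length_inv] at hl
    rcases he with he | he
    · rw [he, length_wordProd_altList hab hn] at hl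
      subst hl
      exact ⟨a, b, hab, rfl, simple_mem_closure_left a b, simple_mem_closure_right a b, he⟩
    · rw [he, length_wordProd_altList hab.symm (by rwa [M.symmetric b a])] at hl
      subst hl
      exact ⟨b, a, hab.symm, M.symmetric b a, simple_mem_closure_right a b,
        simple_mem_closure_left a b, he⟩
  obtain ⟨c, d, hcd, hmm, hc, hd, he⟩ := hp
  have h3 : cs.Red (cs.wordProd (altList a b (M a b)))⁻¹ u⁻¹ := by
    rw [Red, he, hy', length_wordProd_altList_mul hy hcd hc hd (by omega),
      length_wordProd_altList hcd (by omega)]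
  simpa using h3.inv

/-! ### Joins -/

/-- In the right weak order, two elements with an upper bound have a join, and the join can be
reduced-multiplied on the left by everything the two elements can. -/
theorem exists_isJoin (hx : cs.RightWeakLE x z) (hy : cs.RightWeakLE y z) :
    ∃ j, cs.IsJoin x y j ∧ ∀ u, cs.Red u x → cs.Red u y → cs.Red u j := by
  induction hn : cs.length z using Nat.strong_induction_on generalizing x y z with
  | _ n ih =>
    -- A common first letter is cancelled, leaving a shorter upper bound for the induction.
    have step : ∀ (a : B) (x y : W), cs.RightWeakLE x z → cs.RightWeakLE y z →
        cs.RightWeakLE (cs.simple a) x → cs.RightWeakLE (cs.simple a) y →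
        ∃ j, cs.IsJoin x y j ∧ ∀ u, cs.Red u x → cs.Red u y → cs.Red u j := by
      intro a x y hx hy hax hay
      obtain ⟨x', rfl, hx'⟩ := rightWeakLE_iff.1 hax
      obtain ⟨y', rfl, hy'⟩ := rightWeakLE_iff.1 hay
      obtain ⟨z', rfl, hz', hxz⟩ := hx'.exists_of_mul_le hx
      have hyz := hy'.le_of_mul_le_mul hy
      obtain ⟨j, ⟨hj1, hj2, hj3⟩, hr⟩ := ih (cs.length z')
        (by rw [Red, length_simple] at hz'; omega) hxz hyz rfl
      have hj := hz'.of_le (hj3 z' hxz hyz)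
      refine ⟨cs.simple a * j, ⟨hj.mul_le_mul hj1, hj.mul_le_mul hj2, ?_⟩, ?_⟩
      · intro w hw1 hw2
        obtain ⟨w', rfl, hw', h1⟩ := hx'.exists_of_mul_le hw1
        exact hw'.mul_le_mul (hj3 w' h1 (hy'.le_of_mul_le_mul hw2))
      · intro u hu1 hu2
        obtain ⟨h1, h2⟩ := hx'.assoc' hu1
        obtain ⟨h3, h4⟩ := hy'.assoc' hu2
        exact (h1.assoc (hr _ h2 h4)).2
    by_cases hx1 : x = 1
    · subst hx1
      exact ⟨y, ⟨RightWeakLE.one_le y, RightWeakLE.refl y, fun _ _ h => h⟩, fun _ _ h => h⟩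
    by_cases hy1 : y = 1
    · subst hy1
      exact ⟨x, ⟨RightWeakLE.refl x, RightWeakLE.one_le x, fun _ h _ => h⟩, fun _ h _ => h⟩
    obtain ⟨a, hax⟩ := cs.exists_leftDescent_of_ne_one hx1
    obtain ⟨b, hby⟩ := cs.exists_leftDescent_of_ne_one hy1
    rw [← simple_le_iff] at hax hby
    rcases eq_or_ne a b with rfl | hab
    · exact step a x y hx hy hax hby
    · obtain ⟨hm, hd⟩ := wordProd_altList_le_of_simple_le hab (hax.trans hx) (hby.trans hy)
      have had : cs.RightWeakLE (cs.simple a) (cs.wordProd (altList a b (M a b))) := by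
        obtain ⟨n, hn⟩ := Nat.exists_eq_succ_of_ne_zero hm
        rw [simple_le_iff, IsLeftDescent, length_wordProd_altList hab (by omega), hn,
          wordProd_altList_succ, simple_mul_simple_cancel_left,
          length_wordProd_altList hab.symm (by rw [M.symmetric b a]; omega)]
        omega
      have hbd : cs.RightWeakLE (cs.simple b) (cs.wordProd (altList a b (M a b))) := by
        obtain ⟨n, hn⟩ := Nat.exists_eq_succ_of_ne_zero hm
        rw [wordProd_altList_braid, simple_le_iff, IsLeftDescent,
          length_wordProd_altList hab.symm (by rw [M.symmetric b a]; omega), hn,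
          wordProd_altList_succ, simple_mul_simple_cancel_left,
          length_wordProd_altList hab (by omega)]
        omega
      -- Every upper bound is above the longest dihedral element, so it can be joined in first: it
      -- shares `a` with `x`, and the result shares `b` with `y`.
      obtain ⟨j, hj, hjr⟩ := step a x _ hx hd hax had
      obtain ⟨k, hk, hkr⟩ := step b j y (hj.2.2 z hx hd) hy (hbd.trans hj.2.1) hby
      refine ⟨k, ⟨hj.1.trans hk.1, hk.2.1, fun w h1 h2 => ?_⟩, fun u h1 h2 => ?_⟩
      · exact hk.2.2 w (hj.2.2 w h1
          (wordProd_altList_le_of_simple_le hab (hax.trans h1) (hby.trans h2)).2) h2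
      · exact hkr u (hjr u h1 (Red.wordProd_altList hab (h1.of_le hax) (h2.of_le hby))) h2

theorem IsJoin.unique (h : cs.IsJoin x y u) (h' : cs.IsJoin x y v) : u = v :=
  (h.2.2 v h'.1 h'.2.1).antisymm (h'.2.2 u h.1 h.2.1)

/-- A property that is stable under joins has a greatest element below each element. -/
theorem exists_greatest_le (P : W → Prop) (h1 : P 1)
    (hP : ∀ x y j, P x → P y → cs.IsJoin x y j → P j) (z : W) :
    ∃ g, P g ∧ cs.RightWeakLE g z ∧ ∀ x, P x → cs.RightWeakLE x z → cs.RightWeakLE x g := by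
  classical
  have hbdd : ∃ n, ∃ g, (P g ∧ cs.RightWeakLE g z) ∧ cs.length z - cs.length g = n :=
    ⟨_, 1, ⟨h1, RightWeakLE.one_le z⟩, rfl⟩
  obtain ⟨g, ⟨hg, hgz⟩, hgn⟩ := Nat.find_spec hbdd
  refine ⟨g, hg, hgz, fun x hx hxz => ?_⟩
  obtain ⟨j, hj, -⟩ := exists_isJoin hgz hxz
  have hjz := hj.2.2 z hgz hxz
  have hmin := Nat.find_min' hbdd ⟨j, ⟨hP g x j hg hx hj, hjz⟩, rfl⟩
  have := hj.1.eq_of_length_le (by have := hjz.length_le; have := hgz.length_le; omega)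
  exact this ▸ hj.2.1

end WeakOrder

end CoxeterSystem

namespace CoxeterSystem

/-! ### The Artin–Tits monoid: lifts, lengths and heads -/

section Lift

variable {B W : Type*} [Group W] {M : CoxeterMatrix B} (cs : CoxeterSystem M W)

/-- The element of the Artin–Tits monoid represented by a word. -/
def _root_.CoxeterMatrix.artinProd (M : CoxeterMatrix B) (ω : List B) : M.ArtinTitsMonoid :=
  PresentedMonoid.mk M.ArtinTitsRel (FreeMonoid.ofList ω)

theorem artinProd_append (ω ω' : List B) :
    M.artinProd (ω ++ ω') = M.artinProd ω * M.artinProd ω' :=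
  map_mul (PresentedMonoid.mk M.ArtinTitsRel) (FreeMonoid.ofList ω) (FreeMonoid.ofList ω')

theorem artinProd_nil : M.artinProd [] = 1 := map_one (PresentedMonoid.mk M.ArtinTitsRel)

theorem artinProd_cons (i : B) (ω : List B) :
    M.artinProd (i :: ω) = M.artinProd [i] * M.artinProd ω :=
  artinProd_append [i] ω

theorem artinProd_surjective : Function.Surjective M.artinProd :=
  PresentedMonoid.surjective_mk

theorem artinProd_altList_braid {a b : B} (h : M a b ≠ 0) :
    M.artinProd (altList a b (M a b)) = M.artinProd (altList b a (M a b)) := by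
  have key : M.artinProd (alternatingWord a b (M a b)) =
      M.artinProd (alternatingWord b a (M a b)) :=
    PresentedMonoid.mk_eq_mk_of_rel (CoxeterMatrix.ArtinTitsRel.braid a b h)
  rw [alternatingWord_eq_altList, alternatingWord_eq_altList] at key
  split_ifs at key
  · exact key
  · exact key.symm

variable {cs}

theorem IsReduced.of_cons {i : B} {ω : List B} (h : cs.IsReduced (i :: ω)) : cs.IsReduced ω := by
  simpa using h.drop 1

theorem IsReduced.red_append {ω ω' : List B} (h : cs.IsReduced ω) (h' : cs.IsReduced ω')
    (hr : cs.Red (cs.wordProd ω) (cs.wordProd ω')) : cs.IsReduced (ω ++ ω') := by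
  rw [IsReduced, wordProd_append, hr, h.eq, h'.eq, List.length_append]

theorem IsReduced.red_of_append {ω ω' : List B} (h : cs.IsReduced (ω ++ ω')) :
    cs.IsReduced ω ∧ cs.IsReduced ω' ∧ cs.Red (cs.wordProd ω) (cs.wordProd ω') := by
  have h1 := h.take ω.length
  have h2 := h.drop ω.length
  rw [List.take_left] at h1
  rw [List.drop_left] at h2
  refine ⟨h1, h2, ?_⟩
  rw [Red, ← wordProd_append, h.eq, h1.eq, h2.eq, List.length_append]

theorem IsReduced.simple_le {i : B} {ω : List B} (h : cs.IsReduced (i :: ω)) :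
    cs.RightWeakLE (cs.simple i) (cs.wordProd (i :: ω)) := by
  have := (red_of_append (ω := [i]) h).2.2.le
  simpa [wordProd_cons] using this

/-- **Matsumoto's theorem**: two reduced words of the same element of the Coxeter group represent
the same element of the Artin–Tits monoid. -/
theorem IsReduced.artinProd_eq {ω ω' : List B} (h : cs.IsReduced ω) (h' : cs.IsReduced ω')
    (he : cs.wordProd ω = cs.wordProd ω') : M.artinProd ω = M.artinProd ω' := by
  induction hn : ω.length generalizing ω ω' with
  | zero =>
    have hl : ω'.length = 0 := by rw [← h'.eq, ← he, h.eq, hn]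
    rw [List.eq_nil_of_length_eq_zero hn, List.eq_nil_of_length_eq_zero hl]
  | succ n ih =>
    have hl : ω'.length = n + 1 := by rw [← h'.eq, ← he, h.eq, hn]
    obtain ⟨a, ω, rfl⟩ := List.exists_cons_of_length_eq_add_one hn
    obtain ⟨b, ω', rfl⟩ := List.exists_cons_of_length_eq_add_one hl
    rw [List.length_cons, Nat.add_right_cancel_iff] at hn hl
    rcases eq_or_ne a b with rfl | hab
    · rw [wordProd_cons, wordProd_cons, mul_right_inj] at he
      rw [artinProd_cons, ih h.of_cons h'.of_cons he hn, ← artinProd_cons]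
    · obtain ⟨hm, hd⟩ := wordProd_altList_le_of_simple_le hab h.simple_le (he ▸ h'.simple_le)
      obtain ⟨z, hz, hr⟩ := rightWeakLE_iff.1 hd
      obtain ⟨ω'', hω'', rfl⟩ := cs.exists_isReduced z
      have hz' := hz
      rw [he] at hz'
      have h1 := (isReduced_altList hab (by omega)).red_append hω'' hr
      rw [wordProd_altList_braid] at hr hz'
      have h2 := (isReduced_altList hab.symm (by rw [M.symmetric b a]; omega)).red_append hω'' hr
      have hbr := artinProd_altList_braid hm
      rw [← wordProd_append] at hz hz'
      -- By induction on the tails, each word can be replaced by an alternating word followed by the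
      -- same `ω''`; one braid relation then links the two.
      suffices h3 : M.artinProd (a :: ω) = M.artinProd (altList a b (M a b) ++ ω'') ∧
          M.artinProd (b :: ω') = M.artinProd (altList b a (M a b) ++ ω'') by
        rw [h3.1, h3.2, artinProd_append, hbr, artinProd_append]
      obtain ⟨k, hk⟩ := Nat.exists_eq_succ_of_ne_zero hm
      rw [hk, altList, List.cons_append] at hz h1 hz' h2 ⊢
      rw [wordProd_cons, wordProd_cons, mul_right_inj] at hz hz'
      rw [altList, List.cons_append, artinProd_cons, ih h.of_cons h1.of_cons hz hn,
        ← artinProd_cons, artinProd_cons b, ih h'.of_cons h2.of_cons hz' hl, ← artinProd_cons]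
      exact ⟨rfl, rfl⟩

variable (cs)

/-- The canonical section of the projection of the Artin–Tits monoid to the Coxeter group. -/
noncomputable def artinLift (w : W) : M.ArtinTitsMonoid :=
  M.artinProd (cs.exists_isReduced w).choose

variable {cs}

theorem IsReduced.artinLift_wordProd {ω : List B} (h : cs.IsReduced ω) :
    cs.artinLift (cs.wordProd ω) = M.artinProd ω := by
  have hs := (cs.exists_isReduced (cs.wordProd ω)).choose_spec
  exact hs.1.artinProd_eq h hs.2.symm

theorem Red.artinLift_mul {u v : W} (h : cs.Red u v) :
    cs.artinLift (u * v) = cs.artinLift u * cs.artinLift v := by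
  obtain ⟨ω, hω, rfl⟩ := cs.exists_isReduced u
  obtain ⟨ω', hω', rfl⟩ := cs.exists_isReduced v
  rw [← wordProd_append, (hω.red_append hω' h).artinLift_wordProd, hω.artinLift_wordProd,
    hω'.artinLift_wordProd, artinProd_append]

variable (cs)

theorem artinLift_one : cs.artinLift 1 = 1 := by
  have h : cs.IsReduced [] := by simp [IsReduced]
  simpa [artinProd_nil] using h.artinLift_wordProd

theorem artinLift_simple (i : B) : cs.artinLift (cs.simple i) = M.artinProd [i] := by
  have h : cs.IsReduced [i] := by simp [IsReduced]
  simpa using h.artinLift_wordProd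

theorem artinTitsProj_artinProd (ω : List B) :
    cs.artinTitsProj (M.artinProd ω) = cs.wordProd ω := by
  induction ω with
  | nil => rw [artinProd_nil, map_one, wordProd_nil]
  | cons i ω ih => rw [artinProd_cons, map_mul, ih, wordProd_cons]; rfl

theorem artinTitsProj_artinLift (w : W) : cs.artinTitsProj (cs.artinLift w) = w := by
  obtain ⟨ω, hω, rfl⟩ := cs.exists_isReduced w
  rw [hω.artinLift_wordProd, artinTitsProj_artinProd]

theorem _root_.CoxeterMatrix.ArtinTitsMonoid.induction {p : M.ArtinTitsMonoid → Prop}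
    (g : M.ArtinTitsMonoid) (one : p 1) (mul : ∀ i g, p g → p (M.artinProd [i] * g)) : p g := by
  obtain ⟨ω, rfl⟩ := artinProd_surjective g
  induction ω with
  | nil => rwa [artinProd_nil]
  | cons i ω ih => rw [artinProd_cons]; exact mul i _ ih

/-! ### Length in the Artin–Tits monoid -/

theorem prod_map_const_ofAdd (ω : List B) :
    FreeMonoid.lift (fun _ : B => Multiplicative.ofAdd 1) (FreeMonoid.ofList ω) =
      Multiplicative.ofAdd ω.length := by
  rw [FreeMonoid.lift_apply]
  simp [← ofAdd_nsmul]

/-- The length homomorphism of the Artin–Tits monoid. -/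
def _root_.CoxeterMatrix.artinLength (M : CoxeterMatrix B) :
    M.ArtinTitsMonoid →* Multiplicative ℕ :=
  PresentedMonoid.lift (fun _ => Multiplicative.ofAdd 1) fun a b h => by
    obtain ⟨i, j, _⟩ := h
    rw [prod_map_const_ofAdd, prod_map_const_ofAdd]
    simp

theorem artinLength_artinProd (ω : List B) :
    M.artinLength (M.artinProd ω) = Multiplicative.ofAdd ω.length :=
  prod_map_const_ofAdd ω

theorem artinLength_eq_one_iff {g : M.ArtinTitsMonoid} : M.artinLength g = 1 ↔ g = 1 := by
  refine ⟨fun h => ?_, fun h => h ▸ map_one _⟩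
  obtain ⟨ω, rfl⟩ := artinProd_surjective g
  rw [artinLength_artinProd] at h
  have : ω.length = 0 := h
  rw [List.eq_nil_of_length_eq_zero this, artinProd_nil]

/-- The length of an element of the Artin–Tits monoid, as a natural number. -/
def _root_.CoxeterMatrix.artinLen (M : CoxeterMatrix B) (g : M.ArtinTitsMonoid) : ℕ :=
  (M.artinLength g).toAdd

theorem artinLen_mul (g h : M.ArtinTitsMonoid) :
    M.artinLen (g * h) = M.artinLen g + M.artinLen h := by
  simp [CoxeterMatrix.artinLen]

theorem artinLen_eq_zero_iff {g : M.ArtinTitsMonoid} : M.artinLen g = 0 ↔ g = 1 :=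
  artinLength_eq_one_iff

theorem artinLen_artinLift (w : W) : M.artinLen (cs.artinLift w) = cs.length w := by
  obtain ⟨ω, hω, rfl⟩ := cs.exists_isReduced w
  rw [CoxeterMatrix.artinLen, hω.artinLift_wordProd, artinLength_artinProd, hω.eq, toAdd_ofAdd]

/-! ### The head of an element of the Artin–Tits monoid -/

variable {cs} in
theorem Red.isJoin {u x y j : W} (hx : cs.Red u x) (hy : cs.Red u y) (hj : cs.IsJoin x y j) :
    cs.Red u j := by
  obtain ⟨k, hk, hr⟩ := exists_isJoin hj.1 hj.2.1
  exact hj.unique hk ▸ hr u hx hy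

/-- The greatest `x ≤ v` such that `u * x` is reduced. -/
noncomputable def redPart (u v : W) : W :=
  (exists_greatest_le (cs.Red u) (red_one u) (fun _ _ _ => Red.isJoin) v).choose

theorem redPart_spec (u v : W) : cs.Red u (cs.redPart u v) ∧
    cs.RightWeakLE (cs.redPart u v) v ∧
    ∀ x, cs.Red u x → cs.RightWeakLE x v → cs.RightWeakLE x (cs.redPart u v) :=
  (exists_greatest_le (cs.Red u) (red_one u) (fun _ _ _ => Red.isJoin) v).choose_spec

/-- The head of the product of the lifts of `u` and `v`. -/
noncomputable def headMul (u v : W) : W := u * cs.redPart u v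

theorem one_headMul (v : W) : cs.headMul 1 v = v := by
  obtain ⟨-, h2, h3⟩ := cs.redPart_spec 1 v
  rw [headMul, one_mul]
  exact h2.antisymm (h3 v (one_red v) (RightWeakLE.refl v))

variable {cs} in
-- This makes `headMul` compatible with the braid relations, hence an action of the monoid. Both
-- sides are `u` times an element, and maximality of each `redPart` gives the two inequalities.
theorem Red.headMul_headMul {u v : W} (h : cs.Red u v) (w : W) :
    cs.headMul u (cs.headMul v w) = cs.headMul (u * v) w := by
  obtain ⟨c1, c2, c3⟩ := cs.redPart_spec u (v * cs.redPart v w)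
  obtain ⟨d1, d2, d3⟩ := cs.redPart_spec v w
  obtain ⟨e1, e2, e3⟩ := cs.redPart_spec (u * v) w
  unfold headMul
  rw [mul_assoc, mul_right_inj]
  have he := h.assoc e1
  refine RightWeakLE.antisymm ?_ (c3 _ he.2 (d1.mul_le_mul (d3 _ he.1 e2)))
  obtain ⟨y, hy, hvy⟩ := rightWeakLE_iff.1 (c3 v h d1.le)
  rw [hy] at c1 c2 ⊢
  exact he.1.mul_le_mul (e3 y (hvy.assoc' c1).2 ((hvy.le_of_mul_le_mul c2).trans d2))

/-- The map `cs.headMul u`, as an element of the monoid of self-maps of the Coxeter group. -/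
noncomputable def headEnd (u : W) : Function.End W := cs.headMul u

theorem prod_map_headEnd {ω : List B} (h : cs.IsReduced ω) :
    FreeMonoid.lift (fun i => cs.headEnd (cs.simple i)) (FreeMonoid.ofList ω) =
      cs.headEnd (cs.wordProd ω) := by
  induction ω with
  | nil =>
    rw [FreeMonoid.ofList_nil, map_one, wordProd_nil]
    exact (funext cs.one_headMul).symm
  | cons i ω ih =>
    rw [FreeMonoid.ofList_cons, map_mul, ih h.of_cons, FreeMonoid.lift_eval_of]
    have hr := (IsReduced.red_of_append (ω := [i]) h).2.2
    rw [wordProd_singleton] at hr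
    rw [wordProd_cons]
    exact funext hr.headMul_headMul

/-- The action of the Artin–Tits monoid on heads. -/
noncomputable def headAct : M.ArtinTitsMonoid →* Function.End W :=
  PresentedMonoid.lift (rels := M.ArtinTitsRel) (fun i => cs.headEnd (cs.simple i)) fun a b h => by
    obtain ⟨i, j, hm⟩ := h
    rcases eq_or_ne i j with rfl | hij
    · rfl
    have h1 : cs.IsReduced (altList i j (M i j)) := isReduced_altList hij (by omega)
    have h2 : cs.IsReduced (altList j i (M i j)) :=
      isReduced_altList hij.symm (by rw [M.symmetric j i]; omega)
    rw [alternatingWord_eq_altList, alternatingWord_eq_altList]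
    split_ifs
    · rw [prod_map_headEnd cs h1, prod_map_headEnd cs h2, wordProd_altList_braid]
    · rw [prod_map_headEnd cs h1, prod_map_headEnd cs h2, wordProd_altList_braid]

theorem headAct_artinLift (u v : W) : cs.headAct (cs.artinLift u) v = cs.headMul u v := by
  obtain ⟨ω, hω, rfl⟩ := cs.exists_isReduced u
  rw [hω.artinLift_wordProd]
  exact congrFun (cs.prod_map_headEnd hω) v

/-- The greatest element of the Coxeter group whose lift left-divides `g`. -/
noncomputable def head (g : M.ArtinTitsMonoid) : W := cs.headAct g 1

theorem head_one : cs.head 1 = 1 := by rw [head, map_one]; rfl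

theorem head_artinLift_mul (u : W) (g : M.ArtinTitsMonoid) :
    cs.head (cs.artinLift u * g) = cs.headMul u (cs.head g) := by
  rw [head, map_mul, ← headAct_artinLift]
  rfl

variable {cs} in
theorem RightWeakLE.artinLift_dvd {u v : W} (h : cs.RightWeakLE u v) :
    cs.artinLift u ∣ cs.artinLift v := by
  obtain ⟨x, rfl, hx⟩ := rightWeakLE_iff.1 h
  exact ⟨cs.artinLift x, hx.artinLift_mul⟩

theorem artinLift_head_dvd (g : M.ArtinTitsMonoid) : cs.artinLift (cs.head g) ∣ g := by
  induction g using CoxeterMatrix.ArtinTitsMonoid.induction with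
  | one => rw [head_one, artinLift_one]
  | mul i g ih =>
    rw [← cs.artinLift_simple, head_artinLift_mul]
    obtain ⟨h1, h2, -⟩ := cs.redPart_spec (cs.simple i) (cs.head g)
    rw [headMul, h1.artinLift_mul]
    exact mul_dvd_mul_left _ (h2.artinLift_dvd.trans ih)

/-- The head of a product starting with the lift of `u` is `u` times a reduced complement, hence
above `u`. -/
theorem artinLift_dvd_iff {u : W} {g : M.ArtinTitsMonoid} :
    cs.artinLift u ∣ g ↔ cs.RightWeakLE u (cs.head g) := by
  constructor
  · rintro ⟨k, rfl⟩
    rw [head_artinLift_mul]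
    exact (cs.redPart_spec u (cs.head k)).1.le
  · exact fun h => h.artinLift_dvd.trans (cs.artinLift_head_dvd g)

end Lift

end CoxeterSystem

namespace CoxeterSystem

/-! ### Closed sets give Garside families -/

section GarsideFamily

variable {B W : Type*} [Group W] {M : CoxeterMatrix B} (cs : CoxeterSystem M W)

theorem isSuffixOf_iff {v w : W} : cs.IsSuffixOf v w ↔ ∃ u, w = u * v ∧ cs.Red u v := by
  constructor
  · rintro ⟨ω', ω, -, rfl, hω, rfl, ω'', rfl⟩
    exact ⟨cs.wordProd ω'', cs.wordProd_append _ _, hω.red_of_append.2.2⟩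
  · rintro ⟨u, rfl, hr⟩
    obtain ⟨ω, hω, rfl⟩ := cs.exists_isReduced u
    obtain ⟨ω', hω', rfl⟩ := cs.exists_isReduced v
    exact ⟨ω', ω ++ ω', hω', rfl, hω.red_append hω' hr, cs.wordProd_append _ _, ω, rfl⟩

variable {cs}

section Closed

variable {A : Set W} (hS : Set.range cs.simple ⊆ A) (hJ : cs.JoinClosed A)
  (hA : cs.SuffixClosed A)

include hS hJ hA in
-- Both `s i` and `c` lie below the head of the product, so their join exists; `d` is what remains
-- of it after `s i`.
theorem exists_mem_artinLift_dvd_simple_mul {c : W} (hc : c ∈ A) {i : B} {k : M.ArtinTitsMonoid}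
    (h : cs.artinLift c ∣ cs.artinLift (cs.simple i) * k) :
    ∃ d ∈ A, cs.artinLift d ∣ k ∧
      cs.artinLift c ∣ cs.artinLift (cs.simple i) * cs.artinLift d := by
  rw [artinLift_dvd_iff, head_artinLift_mul, headMul] at h
  obtain ⟨h1, h2, -⟩ := cs.redPart_spec (cs.simple i) (cs.head k)
  obtain ⟨j, hj, -⟩ := exists_isJoin h1.le h
  have hjA := hJ _ (hS ⟨i, rfl⟩) _ hc j hj
  obtain ⟨d, rfl, hd⟩ := rightWeakLE_iff.1 hj.1
  refine ⟨d, hA _ hjA d ((cs.isSuffixOf_iff).2 ⟨_, rfl, hd⟩), ?_, ?_⟩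
  · rw [artinLift_dvd_iff]
    exact (hd.le_of_mul_le_mul (hj.2.2 _ h1.le h)).trans h2
  · rw [← hd.artinLift_mul]
    exact hj.2.1.artinLift_dvd

include hS hJ hA in
theorem exists_mem_artinLift_dvd_mul {c : W} (hc : c ∈ A) {f k : M.ArtinTitsMonoid}
    (h : cs.artinLift c ∣ f * k) :
    ∃ d ∈ A, cs.artinLift d ∣ k ∧ cs.artinLift c ∣ f * cs.artinLift d := by
  induction f using CoxeterMatrix.ArtinTitsMonoid.induction generalizing c with
  | one => exact ⟨c, hc, by simpa using h, by simp⟩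
  | mul i f ih =>
    rw [← cs.artinLift_simple, mul_assoc] at h
    obtain ⟨d, hd, hdk, hcd⟩ := exists_mem_artinLift_dvd_simple_mul hS hJ hA hc h
    obtain ⟨e, he, hek, hde⟩ := ih hd hdk
    refine ⟨e, he, hek, hcd.trans ?_⟩
    rw [← cs.artinLift_simple, mul_assoc]
    exact mul_dvd_mul_left _ hde

include hS hJ hA in
theorem isGarsideFamily_image_artinLift (h1 : (1 : W) ∈ A) :
    IsGarsideFamily (cs.artinLift '' A) := by
  refine ⟨⟨1, h1, cs.artinLift_one⟩, fun g => ?_⟩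
  induction hn : M.artinLen g using Nat.strong_induction_on generalizing g with
  | _ n ih =>
    by_cases hg : g = 1
    · exact ⟨[], by simp [hg], by simp [IsNormalSequence]⟩
    -- The greedy first entry; it is nontrivial because `A` contains the first letter of any word
    -- for `g`.
    obtain ⟨a, ha, hag, hmax⟩ := exists_greatest_le (cs := cs) (· ∈ A) h1
      (fun x y j hx hy hj => hJ x hx y hy j hj) (cs.head g)
    simp only [← artinLift_dvd_iff] at hag hmax
    have ha1 : a ≠ 1 := by
      rintro rfl
      obtain ⟨ω, rfl⟩ := artinProd_surjective g
      rcases ω with _ | ⟨i, ω⟩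
      · exact hg artinProd_nil
      · rw [artinProd_cons, ← cs.artinLift_simple] at hmax
        have := (hmax _ (hS ⟨i, rfl⟩) (dvd_mul_right _ _)).length_le
        simp at this
    obtain ⟨r, hr⟩ := hag
    have hlt : M.artinLen r < n := by
      rw [← hn, hr, artinLen_mul, artinLen_artinLift]
      have : cs.length a ≠ 0 := fun h => ha1 (cs.length_eq_zero_iff.1 h)
      omega
    obtain ⟨l, hl, hlA, hlc⟩ := ih _ hlt r rfl
    refine ⟨cs.artinLift a :: l, by rw [List.prod_cons, hl, hr], ?_, ?_⟩
    · simpa using ⟨⟨a, ha, rfl⟩, hlA⟩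
    · rw [List.isChain_cons]
      refine ⟨?_, hlc⟩
      rintro b hb _ ⟨c, hc, rfl⟩ f hdvd
      have hbr : b ∣ r := by
        obtain ⟨l', rfl⟩ := List.head?_eq_some_iff.1 hb
        exact ⟨l'.prod, by rw [← hl, List.prod_cons]⟩
      rw [mul_assoc] at hdvd
      obtain ⟨d, hd, hd1, hd2⟩ := exists_mem_artinLift_dvd_mul hS hJ hA hc hdvd
      have : cs.RightWeakLE d a := hmax d hd (hr ▸ hd1.trans (mul_dvd_mul_left _ hbr))
      exact hd2.trans (mul_dvd_mul_left _ this.artinLift_dvd)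

end Closed

end GarsideFamily

end CoxeterSystem

/-- An element of `F` that left-divides a shifted product of an `F`-normal sequence left-divides
its shifted first entry. -/
theorem IsNormalSequence.dvd_mul_of_dvd_mul_prod {G : Type*} [Monoid G] {F : Set G} {a : G}
    {l : List G} (h : IsNormalSequence F (a :: l)) {s : G} (hs : s ∈ F) {f : G}
    (hd : s ∣ f * (a :: l).prod) : s ∣ f * a := by
  obtain ⟨hF, hc⟩ := h
  induction l generalizing a f with
  | nil => simpa using hd
  | cons b l ih =>
    rw [List.isChain_cons_cons] at hc
    refine hc.1 s hs f (ih (a := b) (f := f * a) ?_ (fun x hx => hF x (List.mem_cons_of_mem _ hx))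
      hc.2)
    rwa [List.prod_cons, ← mul_assoc] at hd

namespace CoxeterSystem

/-! ### Garside families give closed sets -/

section Minimality

variable {B W : Type*} [Group W] {M : CoxeterMatrix B} {cs : CoxeterSystem M W}
  {F : Set M.ArtinTitsMonoid}

theorem prod_mem_of_artinLen_eq_one {l : List M.ArtinTitsMonoid} (hl : M.artinLen l.prod = 1) :
    l.prod ∈ l := by
  induction l with
  | nil => simp [artinLen_eq_zero_iff.2 rfl] at hl
  | cons a l ih =>
    rw [List.prod_cons, artinLen_mul] at hl
    rw [List.prod_cons]
    by_cases h : M.artinLen a = 0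
    · rw [artinLen_eq_zero_iff.1 h, one_mul]
      exact List.mem_cons_of_mem _ (ih (by omega))
    · rw [artinLen_eq_zero_iff.1 (show M.artinLen l.prod = 0 by omega), mul_one]
      exact List.mem_cons_self

theorem eq_of_dvd_of_artinLen_le {g h : M.ArtinTitsMonoid} (hd : g ∣ h)
    (hl : M.artinLen h ≤ M.artinLen g) : h = g := by
  obtain ⟨k, rfl⟩ := hd
  rw [artinLen_mul] at hl
  rw [artinLen_eq_zero_iff.1 (show M.artinLen k = 0 by omega), mul_one]

theorem range_simple_subset_of_isGarsideFamily (hF : IsGarsideFamily F) :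
    Set.range cs.simple ⊆ {w | cs.artinLift w ∈ F} := by
  rintro _ ⟨i, rfl⟩
  obtain ⟨l, hl, hn⟩ := hF.2 (cs.artinLift (cs.simple i))
  have h1 : M.artinLen l.prod = 1 := by rw [hl, artinLen_artinLift, length_simple]
  have h2 := hn.1 _ (prod_mem_of_artinLen_eq_one h1)
  rwa [hl] at h2

/-- The first entry `a` of a normal decomposition of the lift of `w` is divisible by the lifts of
`u` and `v`, hence by that of `w`; it also divides the latter, so lengths force equality. -/
theorem joinClosed_of_isGarsideFamily (hF : IsGarsideFamily F) :
    cs.JoinClosed {w | cs.artinLift w ∈ F} := by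
  intro u hu v hv w hw
  obtain ⟨l, hl, hn⟩ := hF.2 (cs.artinLift w)
  rcases l with _ | ⟨a, l⟩
  · change cs.artinLift w ∈ F
    rw [← hl]
    exact hF.1
  · have hfirst : ∀ x, cs.artinLift x ∈ F → cs.RightWeakLE x w → cs.RightWeakLE x (cs.head a) := by
      intro x hx hxw
      rw [← artinLift_dvd_iff]
      have h1 : cs.artinLift x ∣ 1 * (a :: l).prod := by
        rw [one_mul, hl]
        exact hxw.artinLift_dvd
      simpa using hn.dvd_mul_of_dvd_mul_prod hx h1
    have hwa := hw.2.2 _ (hfirst u hu hw.1) (hfirst v hv hw.2.1)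
    rw [← artinLift_dvd_iff] at hwa
    have haw : a ∣ cs.artinLift w := ⟨l.prod, by rw [← hl, List.prod_cons]⟩
    obtain ⟨k, hk⟩ := hwa
    have : cs.artinLift w = a := by
      refine eq_of_dvd_of_artinLen_le haw ?_
      rw [hk, artinLen_mul]
      omega
    change cs.artinLift w ∈ F
    rw [this]
    exact hn.1 a List.mem_cons_self

/-- With `w = u * v`, normality shifted by the lift of `u` makes the lift of `w` divide that of `u`
times the first entry `a`. So `a` is at least as long as `v`, and is its whole lift. -/
theorem suffixClosed_of_isGarsideFamily (hF : IsGarsideFamily F) :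
    cs.SuffixClosed {w | cs.artinLift w ∈ F} := by
  intro w hw v hv
  obtain ⟨u, rfl, hr⟩ := cs.isSuffixOf_iff.1 hv
  obtain ⟨l, hl, hn⟩ := hF.2 (cs.artinLift v)
  change cs.artinLift v ∈ F
  rcases l with _ | ⟨a, l⟩
  · rw [← hl]
    exact hF.1
  · have h1 : cs.artinLift (u * v) ∣ cs.artinLift u * (a :: l).prod := by
      rw [hl, hr.artinLift_mul]
    obtain ⟨k, hk⟩ := hn.dvd_mul_of_dvd_mul_prod hw h1
    have h2 := congrArg M.artinLen hk
    rw [hr.artinLift_mul, artinLen_mul, artinLen_mul, artinLen_mul] at h2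
    rw [eq_of_dvd_of_artinLen_le (g := a) (h := cs.artinLift v) ⟨l.prod, by rw [← hl, List.prod_cons]⟩ (by omega)]
    exact hn.1 a List.mem_cons_self

end Minimality

end CoxeterSystem

theorem proposition3p2 {B W : Type*} [Nonempty B] [Group W] {M : CoxeterMatrix B}
    (cs : CoxeterSystem M W) :
    ∃ F : Set M.ArtinTitsMonoid,
      IsLeast {F' : Set M.ArtinTitsMonoid | IsGarsideFamily F'} F ∧
      IsLeast {A : Set W | Set.range cs.simple ⊆ A ∧ cs.JoinClosed A ∧ cs.SuffixClosed A}
        (cs.artinTitsProj '' F) := by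
  set C := {A : Set W | Set.range cs.simple ⊆ A ∧ cs.JoinClosed A ∧ cs.SuffixClosed A}
  have hS : Set.range cs.simple ⊆ ⋂₀ C := Set.subset_sInter fun A hA => hA.1
  have hJ : cs.JoinClosed (⋂₀ C) := fun u hu v hv w hw A hA =>
    hA.2.1 u (hu A hA) v (hv A hA) w hw
  have hX : cs.SuffixClosed (⋂₀ C) := fun w hw v hv A hA => hA.2.2 w (hw A hA) v hv
  -- Nonemptiness enters here: the identity is a suffix of a generator.
  have h1 : (1 : W) ∈ ⋂₀ C := by
    obtain ⟨i⟩ := ‹Nonempty B›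
    exact hX _ (hS ⟨i, rfl⟩) 1
      (cs.isSuffixOf_iff.2 ⟨cs.simple i, (mul_one _).symm, CoxeterSystem.red_one _⟩)
  refine ⟨cs.artinLift '' ⋂₀ C,
    ⟨CoxeterSystem.isGarsideFamily_image_artinLift hS hJ hX h1, fun F' hF' => ?_⟩, ?_⟩
  · rintro _ ⟨w, hw, rfl⟩
    exact hw _ ⟨CoxeterSystem.range_simple_subset_of_isGarsideFamily hF',
      CoxeterSystem.joinClosed_of_isGarsideFamily hF',
      CoxeterSystem.suffixClosed_of_isGarsideFamily hF'⟩
  · rw [Set.image_image]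
    simp only [cs.artinTitsProj_artinLift, Set.image_id']
    exact ⟨⟨hS, hJ, hX⟩, fun A hA => Set.sInter_subset_of_mem hA⟩
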